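/- Let $\xi=(x,y,z)^T$, $\hat e_3=(0,0,1)^T$ and $$N=\begin{pmatrix}0&1&0\\0&0&1\\0&0&0\end{pmatrix}.$$ Let $v$ be a $C^\infty$ vector field on $\mathbb{R}^3$ with $\nabla\cdot v=0$ on $\mathbb{R}^3$, $v(0)=0$ and $Dv(0)=N$. Then for every integer $k\ge 0$ there are - a $C^\infty$ diffeomorphism $\psi:\mathbb{R}^3\to\mathbb{R}^3$ that is volume preserving, i.e. $\det D\psi(\xi)=1$ for all $\xi$, and near the identity, i.e. $\psi(\xi)=\xi+O(|\xi|^2)$ as $\xi\to0$, - a real polynomial $p(x,y)$ in two variables, all of whose monomials have degree between $2$ and $k$ (so $p=0$ if $k\le 1$), and - a $C^\infty$ vector field $w$ on $\mathbb{R}^3$ such that $\psi$ transforms $v$ into $w$, i.e. $D\psi(\xi)\,v(\xi)=w(\psi(\xi))$ for all $\xi\in\mathbb{R}^3$, and $$w(\eta)=N\eta+\hat e_3\,p(\eta_1,\eta_2)+O(|\eta|^{k+1})\qquad(\eta\to0).$$ -/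

import Mathlib

open scoped Topology Manifold ContDiff

noncomputable section

/-- Euclidean three-space, with coordinates `x = ξ 0`, `y = ξ 1`, `z = ξ 2`. -/
abbrev E3 : Type := EuclideanSpace ℝ (Fin 3)

/-- The 3 × 3 nilpotent Jordan block. -/
def jordanN : Matrix (Fin 3) (Fin 3) ℝ :=
  !![0, 1, 0;
     0, 0, 1;
     0, 0, 0]

/-- The linear vector field `ξ ↦ N ξ` as a continuous linear map. -/
def linN : E3 →L[ℝ] E3 := Matrix.toEuclideanCLM (𝕜 := ℝ) jordanN

/-- The third standard basis vector. -/
def e₃ : E3 := EuclideanSpace.single 2 1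

/-- The divergence `∂v₀/∂x + ∂v₁/∂y + ∂v₂/∂z` at `ξ`. -/
def divergence (v : E3 → E3) (ξ : E3) : ℝ :=
  ∑ i : Fin 3, (fderiv ℝ v ξ (EuclideanSpace.single i 1)) i

/-- The normal form `η ↦ N η + e₃ p(x, y)`. -/
def normalForm (p : MvPolynomial (Fin 2) ℝ) (η : E3) : E3 :=
  linN η + MvPolynomial.eval ![η 0, η 1] p • e₃

/-- A map is volume preserving when its Jacobian determinant is identically one. -/
def IsVolumePreserving (ψ : E3 → E3) : Prop :=
  ∀ ξ, (fderiv ℝ ψ ξ).det = 1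

/-- `ψ` is near the identity: `ψ(ξ) = ξ + h(ξ)` where `h` has only terms of degree at least two.
In particular `ψ 0 = 0`. -/
def IsNearIdentity (ψ : E3 → E3) : Prop :=
  (fun ξ => ψ ξ - ξ) =O[𝓝 0] (fun ξ => ‖ξ‖ ^ 2)

/-- `ψ` transforms the vector field `v` into the vector field `w`: `Dψ(ξ) v(ξ) = w(ψ(ξ))`. -/
def Conjugates (ψ v w : E3 → E3) : Prop :=
  ∀ ξ, fderiv ℝ ψ ξ (v ξ) = w (ψ ξ)

end

/-!
The field is normalized one degree at a time. If `w = N η + e₃ p(x, y) + F + O(|η|ᵐ⁺¹)` with `F`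
homogeneous of degree `m`, then `div F = 0`, and a volume-preserving map `ξ + h(ξ) + O(|ξ|ᵐ⁺¹)`
replaces `F` by `F + [h, N]`, where `[h, N] = Dh N ξ - N h`. Two facts make this work.

*The homological equation* (`exists_homological_solution`). With `D = y ∂ₓ + z ∂_y` (`lieN`), the
first two components of `F + [h, N]` vanish exactly when `h₁ = F₀ + D h₀` and `h₂ = F₁ + D h₁`.
Then `div h = 0` reads `(∂ₓ + ∂_y D + ∂_z D²) h₀ = g` with `g` given, and it forces the third
component of `F + [h, N]` to be independent of `z`. The operator on the left is onto
(`exists_divOp_eq`): moving derivatives past powers of `D` gives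
`(∂ₓ + ∂_y D + ∂_z D²) Dⁿ = c Dⁿ ∂ₓ + Dⁿ⁺¹ (…)` with `c > 0`, the derivation `D` is nilpotent on
homogeneous polynomials of a given degree, and `∂ₓ` is onto.

*Realization by global diffeomorphisms* (`exists_volumeConjugate_of_polyDiv_eq_zero`). No flows or
cut-offs are needed: every divergence-free homogeneous polynomial field is a sum of shear fields
`q d`, where `d` is a constant vector along which `q` is constant (`mem_span_shearFields`). The map
`ξ ↦ ξ + q(ξ) d` is a polynomial diffeomorphism with inverse `η ↦ η - q(η) d` and Jacobian
determinant `1`, and it preserves the class of divergence-free fields. Fields of Hamiltonian type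
are reduced to shears by polarization: the powers `(xᵢ + t xⱼ)ⁿ` span the binary forms.

The passage between smooth functions and polynomials rests on `exists_homogeneous_isBigO` (the next
Taylor term) and `partialDeriv_isBigO` (derivatives of a smooth `O(|ξ|ⁿ⁺¹)` are `O(|ξ|ⁿ)`).
-/

noncomputable section

open MvPolynomial Asymptotics Filter
open scoped Topology Manifold ContDiff

/-! ### The homological equation for divergence-free polynomial fields -/

/-- Real polynomials in the three coordinates of `E3`. -/
abbrev Poly3 : Type := MvPolynomial (Fin 3) ℝ

/-- The derivation `y ∂ₓ + z ∂_y` of polynomials, i.e. the Lie derivative along `ξ ↦ N ξ`. -/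
def lieN : Derivation ℝ Poly3 Poly3 :=
  (X 1 : Poly3) • pderiv 0 + (X 2 : Poly3) • pderiv 1

theorem lieN_apply (f : Poly3) : lieN f = X 1 * pderiv 0 f + X 2 * pderiv 1 f := rfl

theorem pderiv_pderiv_comm {σ : Type*} (i j : σ) (f : MvPolynomial σ ℝ) :
    pderiv i (pderiv j f) = pderiv j (pderiv i f) := by
  classical
  have h : ⁅(pderiv i : Derivation ℝ (MvPolynomial σ ℝ) (MvPolynomial σ ℝ)),
      (pderiv j : Derivation ℝ (MvPolynomial σ ℝ) (MvPolynomial σ ℝ))⁆ = 0 := by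
    refine derivation_ext fun k => ?_
    rw [Derivation.commutator_apply]
    simp only [pderiv_X, Derivation.zero_apply, Pi.single_apply]
    split_ifs <;> simp
  have h2 := congrArg (fun D => D f) h
  simpa [Derivation.commutator_apply, sub_eq_zero] using h2

theorem pderiv_zero_lieN (f : Poly3) : pderiv 0 (lieN f) = lieN (pderiv 0 f) := by
  simp only [lieN_apply, map_add, pderiv_mul, pderiv_X, Pi.single_apply, pderiv_pderiv_comm 1 0 f]
  simp

theorem pderiv_zero_lieN_iterate (n : ℕ) (f : Poly3) :
    pderiv 0 (lieN^[n] f) = lieN^[n] (pderiv 0 f) := by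
  induction n with
  | zero => rfl
  | succ n ih => rw [Function.iterate_succ_apply', pderiv_zero_lieN, ih,
      ← Function.iterate_succ_apply' lieN]

theorem pderiv_one_lieN (f : Poly3) :
    pderiv 1 (lieN f) = lieN (pderiv 1 f) + pderiv 0 f := by
  simp only [lieN_apply, map_add, pderiv_mul, pderiv_X, Pi.single_apply, pderiv_pderiv_comm 1 0 f]
  simp; ring

theorem pderiv_two_lieN (f : Poly3) :
    pderiv 2 (lieN f) = lieN (pderiv 2 f) + pderiv 1 f := by
  simp only [lieN_apply, map_add, pderiv_mul, pderiv_X, Pi.single_apply,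
    pderiv_pderiv_comm 2 0 f, pderiv_pderiv_comm 2 1 f]
  simp; ring

theorem isHomogeneous_lieN {f : Poly3} {n : ℕ} (hn : n ≠ 0) (hf : f.IsHomogeneous n) :
    (lieN f).IsHomogeneous n := by
  have e : 1 + (n - 1) = n := by omega
  have h (i j : Fin 3) : (X i * pderiv j f).IsHomogeneous n := by
    simpa [e] using (isHomogeneous_X ℝ i).mul (hf.pderiv (i := j))
  exact (h 1 0).add (h 2 1)

/-- The commutator lowers the order of `lieN` by one; one factor `lieN` is kept on the left so that
the exponents need no subtraction. -/
theorem lieN_pderiv_one_iterate (n : ℕ) (f : Poly3) :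
    lieN (pderiv 1 (lieN^[n] f)) = lieN^[n + 1] (pderiv 1 f) + n • lieN^[n] (pderiv 0 f) := by
  induction n with
  | zero => simp
  | succ n ih =>
    rw [Function.iterate_succ_apply' lieN n f, pderiv_one_lieN, map_add, ih,
      pderiv_zero_lieN_iterate, map_add,
      map_nsmul, ← Function.iterate_succ_apply' lieN, ← Function.iterate_succ_apply' lieN,
      add_assoc, ← succ_nsmul]

theorem lieN_lieN_pderiv_two_iterate (n : ℕ) (f : Poly3) :
    ∃ c : ℕ, lieN (lieN (pderiv 2 (lieN^[n] f))) =
      lieN^[n + 2] (pderiv 2 f) + n • lieN^[n + 1] (pderiv 1 f) + c • lieN^[n] (pderiv 0 f) := by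
  induction n with
  | zero => exact ⟨0, by simp⟩
  | succ n ih =>
    obtain ⟨c, hc⟩ := ih
    refine ⟨c + n, ?_⟩
    rw [Function.iterate_succ_apply' lieN n f, pderiv_two_lieN, map_add, map_add, hc,
      lieN_pderiv_one_iterate]
    simp only [map_add, map_nsmul, ← Function.iterate_succ_apply' lieN]
    simp only [nsmul_eq_mul]
    push_cast
    ring

/-- A homogeneous polynomial has a homogeneous antiderivative in each variable. -/
theorem exists_pderiv_eq {σ : Type*} (i : σ) {f : MvPolynomial σ ℝ} {n : ℕ}
    (hf : f.IsHomogeneous n) :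
    ∃ g : MvPolynomial σ ℝ, g.IsHomogeneous (n + 1) ∧ pderiv i g = f := by
  refine ⟨∑ s ∈ f.support, monomial (s + Finsupp.single i 1) (coeff s f / ((s i : ℝ) + 1)),
    IsHomogeneous.sum _ _ _ fun s hs => isHomogeneous_monomial _ ?_, ?_⟩
  · have : s.degree = n := by
      by_contra h
      exact (mem_support_iff.1 hs) (hf.coeff_eq_zero h)
    simp [this]
  · conv_rhs => rw [f.as_sum]
    rw [map_sum]
    refine Finset.sum_congr rfl fun s _ => ?_
    have h : (s i : ℝ) + 1 ≠ 0 := by positivity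
    rw [pderiv_monomial, add_tsub_cancel_right]
    congr 1
    simp
    field_simp

/-- `lieN` lowers by one the weight for which `x`, `y`, `z` have weights `2`, `1`, `0`. -/
theorem lieN_iterate_monomial (n : ℕ) (s : Fin 3 →₀ ℕ) (c : ℝ) (h : 2 * s 0 + s 1 < n) :
    lieN^[n] (monomial s c) = 0 := by
  induction n generalizing s c with
  | zero => omega
  | succ n ih =>
    have key : lieN (monomial s c) =
        monomial (Finsupp.single 1 1 + (s - Finsupp.single 0 1)) (c * s 0) +
        monomial (Finsupp.single 2 1 + (s - Finsupp.single 1 1)) (c * s 1) := by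
      rw [lieN_apply, pderiv_monomial, pderiv_monomial, X, X, monomial_mul, monomial_mul,
        one_mul, one_mul]
    rw [Function.iterate_succ_apply, key, iterate_map_add]
    have h0 : lieN^[n]
        (monomial (Finsupp.single 1 1 + (s - Finsupp.single 0 1)) (c * s 0)) = 0 := by
      by_cases hs : s 0 = 0
      · simp [hs, iterate_map_zero]
      · exact ih _ _ (by simp; omega)
    have h1 : lieN^[n]
        (monomial (Finsupp.single 2 1 + (s - Finsupp.single 1 1)) (c * s 1)) = 0 := by
      by_cases hs : s 1 = 0
      · simp [hs, iterate_map_zero]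
      · exact ih _ _ (by simp; omega)
    rw [h0, h1, add_zero]

theorem lieN_iterate_eq_zero {f : Poly3} {m : ℕ} (hf : f.IsHomogeneous m) :
    lieN^[2 * m + 1] f = 0 := by
  rw [f.as_sum]
  have : ∀ t : Finset (Fin 3 →₀ ℕ), t ⊆ f.support →
      lieN^[2 * m + 1] (∑ s ∈ t, monomial s (coeff s f)) = 0 := by
    intro t
    induction t using Finset.induction_on with
    | empty => intro _; simp [iterate_map_zero]
    | insert s t hst ih =>
      intro ht
      rw [Finset.sum_insert hst, iterate_map_add,
        ih ((Finset.subset_insert _ _).trans ht), add_zero]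
      apply lieN_iterate_monomial
      have hs : s.degree = m := by
        by_contra h
        exact (mem_support_iff.1 (ht (Finset.mem_insert_self _ _))) (hf.coeff_eq_zero h)
      rw [Finsupp.degree_eq_sum, Fin.sum_univ_three] at hs
      omega
  exact this _ subset_rfl

/-- The operator `∂ₓ + ∂_y D + ∂_z D²`, with `D = lieN`, that governs the divergence of a
solution of the homological equation. -/
def divOp (f : Poly3) : Poly3 :=
  pderiv 0 f + pderiv 1 (lieN f) + pderiv 2 (lieN (lieN f))

theorem divOp_iterate (n : ℕ) (f : Poly3) :
    ∃ c : ℕ, divOp (lieN^[n] f) = (c + 1) • lieN^[n] (pderiv 0 f) +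
      lieN^[n + 1] ((n + 3) • pderiv 1 f + lieN (pderiv 2 f)) := by
  obtain ⟨c, hc⟩ := lieN_lieN_pderiv_two_iterate n f
  refine ⟨c + 3 * n + 2, ?_⟩
  rw [divOp, pderiv_two_lieN, pderiv_one_lieN, pderiv_two_lieN, map_add, hc,
    lieN_pderiv_one_iterate, pderiv_zero_lieN_iterate, iterate_map_add, iterate_map_nsmul,
    ← Function.iterate_succ_apply lieN]
  simp only [nsmul_eq_mul]
  push_cast
  ring

theorem divOp_add (f g : Poly3) : divOp (f + g) = divOp f + divOp g := by
  simp only [divOp, map_add]; ring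

theorem divOp_smul (c : ℝ) (f : Poly3) : divOp (c • f) = c • divOp f := by
  simp only [divOp, Derivation.map_smul, smul_add]

theorem isHomogeneous_lieN_iterate {f : Poly3} {m : ℕ} (hm : m ≠ 0) (hf : f.IsHomogeneous m)
    (n : ℕ) : (lieN^[n] f).IsHomogeneous m := by
  induction n with
  | zero => exact hf
  | succ n ih => rw [Function.iterate_succ_apply']; exact isHomogeneous_lieN hm ih

theorem IsHomogeneous.const_smul {σ : Type*} {f : MvPolynomial σ ℝ} {n : ℕ}
    (hf : f.IsHomogeneous n) (c : ℝ) : (c • f).IsHomogeneous n := by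
  rw [smul_eq_C_mul]; exact hf.C_mul c

/-- By `divOp_iterate` and the surjectivity of `∂ₓ`, the range of `divOp` contains `Dⁿ f` as soon
as it contains the range of `Dⁿ⁺¹`; since `D` is nilpotent in each degree, `divOp` is onto. -/
theorem exists_divOp_eq {f : Poly3} {m : ℕ} (hm : m ≠ 0) (hf : f.IsHomogeneous m) :
    ∃ g : Poly3, g.IsHomogeneous (m + 1) ∧ divOp g = f := by
  suffices H : ∀ j n : ℕ, n + j = 2 * m + 1 → ∀ f : Poly3, f.IsHomogeneous m →
      ∃ g : Poly3, g.IsHomogeneous (m + 1) ∧ divOp g = lieN^[n] f from H _ 0 (zero_add _) f hf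
  intro j
  induction j with
  | zero =>
    rintro n rfl f hf
    exact ⟨0, isHomogeneous_zero _ _ _, by rw [lieN_iterate_eq_zero hf]; simp [divOp]⟩
  | succ j ih =>
    intro n hn f hf
    obtain ⟨a, ha, rfl⟩ := exists_pderiv_eq 0 hf
    obtain ⟨c, hc⟩ := divOp_iterate n a
    have hr : ((n + 3) • pderiv 1 a + lieN (pderiv 2 a)).IsHomogeneous m := by
      have h (i : Fin 3) : (pderiv i a).IsHomogeneous m := by simpa using ha.pderiv (i := i)
      refine IsHomogeneous.add ?_ (isHomogeneous_lieN hm (h 2))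
      rw [← Nat.cast_smul_eq_nsmul ℝ]
      exact IsHomogeneous.const_smul (h 1) _
    obtain ⟨b, hb, hb'⟩ := ih (n + 1) (by omega) _ hr
    refine ⟨((c + 1 : ℕ) : ℝ)⁻¹ • (lieN^[n] a + (-1 : ℝ) • b), IsHomogeneous.const_smul
      ((isHomogeneous_lieN_iterate (by omega) ha n).add (IsHomogeneous.const_smul hb _)) _, ?_⟩
    have h0 : ((c + 1 : ℕ) : ℝ) ≠ 0 := by positivity
    rw [divOp_smul, divOp_add, divOp_smul, hb', hc, inv_smul_eq_iff₀ h0,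
      Nat.cast_smul_eq_nsmul ℝ, neg_one_smul, add_neg_cancel_right]

/-- The divergence of a polynomial vector field. -/
def polyDiv (h : Fin 3 → Poly3) : Poly3 := ∑ i, pderiv i (h i)

/-- The homological equation: in degree `m ≥ 2`, a divergence-free field `F` is, up to the Lie
bracket of `N ξ` with a divergence-free field `h`, equal to `(0, 0, r)` with `r` independent of
`z`. -/
theorem exists_homological_solution {m : ℕ} (hm : 2 ≤ m) {F : Fin 3 → Poly3}
    (hF : ∀ i, (F i).IsHomogeneous m) (hdiv : polyDiv F = 0) :
    ∃ (h : Fin 3 → Poly3) (r : Poly3), (∀ i, (h i).IsHomogeneous m) ∧ polyDiv h = 0 ∧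
      r.IsHomogeneous m ∧ pderiv 2 r = 0 ∧
      F 0 + lieN (h 0) - h 1 = 0 ∧ F 1 + lieN (h 1) - h 2 = 0 ∧ F 2 + lieN (h 2) = r := by
  obtain ⟨m, rfl⟩ : ∃ n, m = n + 1 := ⟨m - 1, by omega⟩
  have hp {f : Poly3} (hf : f.IsHomogeneous (m + 1)) (i : Fin 3) :
      (pderiv i f).IsHomogeneous m := by simpa using hf.pderiv (i := i)
  have hD {f : Poly3} (hf : f.IsHomogeneous (m + 1)) := isHomogeneous_lieN (by omega) hf
  obtain ⟨a, ha, ha'⟩ := exists_divOp_eq (m := m) (by omega)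
    (((hp (hF 0) 1).add ((hp (hF 1) 2).add (hp (hD (hF 0)) 2))).neg)
  have hb := (hF 0).add (hD ha)
  have hc := (hF 1).add (hD hb)
  rw [polyDiv, Fin.sum_univ_three] at hdiv
  have hdiv' : pderiv 0 a + pderiv 1 (F 0 + lieN a) + pderiv 2 (F 1 + lieN (F 0 + lieN a)) = 0 := by
    rw [divOp] at ha'
    simp only [map_add]
    linear_combination ha'
  refine ⟨![a, F 0 + lieN a, F 1 + lieN (F 0 + lieN a)],
    F 2 + lieN (F 1 + lieN (F 0 + lieN a)), ?_, ?_, (hF 2).add (hD hc), ?_, ?_, ?_, rfl⟩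
  · intro i
    fin_cases i
    exacts [ha, hb, hc]
  · rw [polyDiv, Fin.sum_univ_three]
    exact hdiv'
  · have h1 := congrArg lieN hdiv'
    rw [map_add (pderiv 2), pderiv_two_lieN]
    generalize hy : F 1 + lieN (F 0 + lieN a) = c at *
    generalize hx : F 0 + lieN a = b at *
    have h2 := congrArg (pderiv 0) hx
    have h3 := congrArg (pderiv 1) hy
    rw [map_add, pderiv_zero_lieN] at h2
    rw [map_add, pderiv_one_lieN] at h3
    rw [map_add, map_add, map_zero] at h1
    linear_combination hdiv + h1 - h2 - h3
  · simp
  · simp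

/-! ### Divergence-free polynomial fields are sums of shears -/

/-- The homogeneous polynomial shear fields `q d` of degree `m`: the constant vector `d` is
multiplied by a polynomial `q` whose derivative along `d` vanishes. -/
def shearFields (m : ℕ) : Set (Fin 3 → Poly3) :=
  {h | ∃ (q : Poly3) (d : Fin 3 → ℝ), q.IsHomogeneous m ∧ ∑ i, d i • pderiv i q = 0 ∧
    h = fun i => d i • q}

/-- The Hamiltonian field `∂ⱼA eᵢ - ∂ᵢA eⱼ` in the coordinate plane of `i` and `j`. -/
def hamField (i j : Fin 3) : Poly3 →ₗ[ℝ] (Fin 3 → Poly3) :=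
  LinearMap.single ℝ _ i ∘ₗ (pderiv j : Derivation ℝ Poly3 Poly3).toLinearMap -
    LinearMap.single ℝ _ j ∘ₗ (pderiv i : Derivation ℝ Poly3 Poly3).toLinearMap

theorem hamField_apply (i j : Fin 3) (A : Poly3) :
    hamField i j A = Pi.single i (pderiv j A) - Pi.single j (pderiv i A) := rfl

/-- If a vector-valued polynomial function of `t` takes values in a subspace, then its coefficients
lie in that subspace. -/
theorem Submodule.coeff_mem_of_forall_sum_pow_smul_mem {M : Type*} [AddCommGroup M] [Module ℝ M]
    (W : Submodule ℝ M) (N : ℕ) (a : ℕ → M)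
    (h : ∀ t : ℝ, ∑ l ∈ Finset.range N, t ^ l • a l ∈ W) {l : ℕ} (hl : l < N) : a l ∈ W := by
  rw [← Submodule.Quotient.mk_eq_zero W, ← Module.forall_dual_apply_eq_zero_iff ℝ]
  intro φ
  let P : Polynomial ℝ := ∑ l ∈ Finset.range N,
    Polynomial.monomial l (φ (Submodule.Quotient.mk (a l)))
  have hP : P = 0 := by
    refine Polynomial.funext fun t => ?_
    have := congrArg φ ((Submodule.Quotient.mk_eq_zero W).2 (h t))
    rw [← Submodule.mkQ_apply, map_sum, map_sum, map_zero] at this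
    simp only [P, Polynomial.eval_finsetSum, Polynomial.eval_monomial, Polynomial.eval_zero]
    rw [← this]
    exact Finset.sum_congr rfl fun l _ => by simp [mul_comm]
  have := congrArg (fun P => Polynomial.coeff P l) hP
  simpa [P, Polynomial.finsetSum_coeff, Polynomial.coeff_monomial, hl] using this

/-- A polynomial `M (xᵢ + t xⱼ)ⁿ` with `M` independent of `xᵢ`, `xⱼ` is constant along
`t eᵢ - eⱼ`, so its Hamiltonian field is a shear. -/
theorem hamField_mul_pow_mem {i j : Fin 3} (hij : i ≠ j) {M : Poly3} {m k n : ℕ}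
    (hM : M.IsHomogeneous k) (hk : k + n = m + 1) (hi : pderiv i M = 0) (hj : pderiv j M = 0)
    (t : ℝ) : hamField i j (M * (X i + C t * X j) ^ n) ∈ shearFields m := by
  have hl : (X i + C t * X j : Poly3).IsHomogeneous 1 :=
    (isHomogeneous_X ℝ i).add ((isHomogeneous_X ℝ j).C_mul t)
  have hii (n : ℕ) : pderiv i (M * (X i + C t * X j) ^ n) =
      M * ((n : Poly3) * (X i + C t * X j) ^ (n - 1)) := by
    simp [hi, pderiv_X, hij]
  have hjj (n : ℕ) : pderiv j (M * (X i + C t * X j) ^ n) =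
      C t * (M * ((n : Poly3) * (X i + C t * X j) ^ (n - 1))) := by
    simp [hj, pderiv_X, hij]
    ring
  have hother (d : Fin 3 → ℝ) (f : Fin 3 → Poly3) (hd : ∀ l, l ≠ i → l ≠ j → d l = 0) :
      ∑ l, d l • f l = d i • f i + d j • f j := by
    rw [← Finset.sum_pair hij (f := fun l => d l • f l)]
    refine (Finset.sum_subset (Finset.subset_univ _) fun l _ hl => ?_).symm
    simp only [Finset.mem_insert, Finset.mem_singleton, not_or] at hl
    rw [hd l hl.1 hl.2, zero_smul]
  refine ⟨M * ((n : Poly3) * (X i + C t * X j) ^ (n - 1)), Pi.single i t - Pi.single j 1,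
    ?_, ?_, ?_⟩
  · rcases Nat.eq_zero_or_pos n with rfl | hn
    · simpa using isHomogeneous_zero _ _ _
    · have h1 := (hM.mul (hl.pow (n - 1))).C_mul (n : ℝ)
      rw [show k + 1 * (n - 1) = m by omega] at h1
      convert h1 using 1
      rw [map_natCast]
      ring
  · rw [hother]
    · have e : M * ((n : Poly3) * (X i + C t * X j) ^ (n - 1)) =
          (n : ℝ) • (M * (X i + C t * X j) ^ (n - 1)) := by
        rw [smul_eq_C_mul, map_natCast]; ring
      rw [e, Derivation.map_smul, Derivation.map_smul, hii, hjj]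
      simp [hij, hij.symm, smul_eq_C_mul]
      ring
    · intro l h1 h2
      simp [h1, h2]
  · rw [hamField_apply, hii, hjj]
    ext1 l
    by_cases h1 : l = i
    · subst h1; simp [hij, smul_eq_C_mul]
    · by_cases h2 : l = j
      · subst h2; simp [h1]
      · simp [h1, h2]

theorem hamField_monomial_mem {i j : Fin 3} (hij : i ≠ j) (s : Fin 3 →₀ ℕ) (c : ℝ) {m : ℕ}
    (hs : s.degree = m + 1) :
    hamField i j (monomial s c) ∈ Submodule.span ℝ (shearFields m) := by
  set u := (s.erase i).erase j with hu
  have hui : u i = 0 := by rw [hu, Finsupp.erase_ne hij, Finsupp.erase_same]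
  have huj : u j = 0 := by simp [hu]
  have hsu : s = u + Finsupp.single i (s i) + Finsupp.single j (s j) := by
    ext l
    by_cases h1 : l = i
    · subst h1; simp [hui, hij.symm]
    · by_cases h2 : l = j
      · subst h2; simp [huj, h1]
      · simp [hu, h1, h2]
  have hdeg : u.degree + (s i + s j) = m + 1 := by
    rw [← hs]
    conv_rhs => rw [hsu]
    simp [add_assoc]
  have hmono (a b : ℕ) : monomial u c * X i ^ a * X j ^ b =
      monomial (u + Finsupp.single i a + Finsupp.single j b) c := by
    rw [X_pow_eq_monomial, X_pow_eq_monomial, monomial_mul, monomial_mul, mul_one, mul_one]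
  set n := s i + s j with hn
  have hmem (t : ℝ) : ∑ l ∈ Finset.range (n + 1),
      t ^ l • hamField i j ((n.choose l : ℝ) • (monomial u c * X i ^ (n - l) * X j ^ l)) ∈
      Submodule.span ℝ (shearFields m) := by
    have h := hamField_mul_pow_mem hij (M := monomial u c) (isHomogeneous_monomial c rfl) hdeg
      (by simp [pderiv_monomial, hui]) (by simp [pderiv_monomial, huj]) t
    suffices e : ∑ l ∈ Finset.range (n + 1),
        t ^ l • hamField i j ((n.choose l : ℝ) • (monomial u c * X i ^ (n - l) * X j ^ l)) =
        hamField i j (monomial u c * (X i + C t * X j) ^ n) from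
      e ▸ Submodule.subset_span h
    rw [add_comm (X i), add_pow, Finset.mul_sum, map_sum]
    refine Finset.sum_congr rfl fun l _ => ?_
    rw [← map_smul]
    congr 1
    rw [smul_eq_C_mul, smul_eq_C_mul, map_natCast, mul_pow, map_pow]
    ring
  have h := Submodule.coeff_mem_of_forall_sum_pow_smul_mem _ _ _ hmem
    (show s j < n + 1 by omega)
  rw [map_smul, hmono, show n - s j = s i by omega, ← hsu] at h
  have hc : ((n.choose (s j) : ℕ) : ℝ) ≠ 0 :=
    Nat.cast_ne_zero.2 (Nat.choose_pos (by omega)).ne'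
  exact (Submodule.smul_mem_iff _ hc).1 h

theorem hamField_mem {i j : Fin 3} (hij : i ≠ j) {A : Poly3} {m : ℕ}
    (hA : A.IsHomogeneous (m + 1)) :
    hamField i j A ∈ Submodule.span ℝ (shearFields m) := by
  rw [A.as_sum, map_sum]
  refine Submodule.sum_mem _ fun s hs => hamField_monomial_mem hij s _ ?_
  by_contra h
  exact (mem_support_iff.1 hs) (hA.coeff_eq_zero h)

/-- Hamiltonian fields in the `yz`- and `xz`-planes remove the first two components of a
divergence-free field; what remains is a shear in the direction of the third axis. -/
theorem mem_span_shearFields {m : ℕ} {h : Fin 3 → Poly3} (hh : ∀ i, (h i).IsHomogeneous m)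
    (hdiv : polyDiv h = 0) : h ∈ Submodule.span ℝ (shearFields m) := by
  obtain ⟨A, hA, hA'⟩ := exists_pderiv_eq 2 (hh 0)
  obtain ⟨B, hB, hB'⟩ := exists_pderiv_eq 2 (hh 1)
  have hp {f : Poly3} (hf : f.IsHomogeneous (m + 1)) (i : Fin 3) :
      (pderiv i f).IsHomogeneous m := by simpa using hf.pderiv (i := i)
  rw [polyDiv, Fin.sum_univ_three] at hdiv
  set r : Poly3 := h 2 + pderiv 0 A + pderiv 1 B with hr
  have hrm : (fun i => (Pi.single 2 1 : Fin 3 → ℝ) i • r) ∈ shearFields m := by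
    refine ⟨r, Pi.single 2 1, ((hh 2).add (hp hA 0)).add (hp hB 1), ?_, rfl⟩
    simp only [Fin.sum_univ_three, hr, map_add]
    rw [pderiv_pderiv_comm 2 0, pderiv_pderiv_comm 2 1, hA', hB']
    simp
    linear_combination hdiv
  have e : h = hamField 0 2 A + hamField 1 2 B + fun i => (Pi.single 2 1 : Fin 3 → ℝ) i • r := by
    ext1 i
    fin_cases i <;> simp [hamField_apply, hA', hB', hr]
    ring
  rw [e]
  exact add_mem (add_mem (hamField_mem (by decide) hA) (hamField_mem (by decide) hB))
    (Submodule.subset_span hrm)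

/-! ### Taylor expansion of smooth functions by homogeneous polynomials -/

/-- The partial derivative of `f` with respect to the `i`-th coordinate. -/
def partialDeriv (i : Fin 3) (f : E3 → ℝ) (ξ : E3) : ℝ :=
  fderiv ℝ f ξ (EuclideanSpace.single i 1)

/-- The function on `E3` given by a polynomial in the coordinates. -/
def polyFun (P : Poly3) (ξ : E3) : ℝ := eval (fun i => ξ i) P

theorem polyFun_add (P Q : Poly3) (ξ : E3) : polyFun (P + Q) ξ = polyFun P ξ + polyFun Q ξ :=
  map_add _ _ _

theorem polyFun_sub (P Q : Poly3) (ξ : E3) : polyFun (P - Q) ξ = polyFun P ξ - polyFun Q ξ :=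
  map_sub _ _ _

theorem polyFun_mul (P Q : Poly3) (ξ : E3) : polyFun (P * Q) ξ = polyFun P ξ * polyFun Q ξ :=
  map_mul _ _ _

theorem polyFun_smul (c : ℝ) (P : Poly3) (ξ : E3) : polyFun (c • P) ξ = c * polyFun P ξ :=
  smul_eval _ _ _

theorem polyFun_sum {ι : Type*} (s : Finset ι) (P : ι → Poly3) (ξ : E3) :
    polyFun (∑ i ∈ s, P i) ξ = ∑ i ∈ s, polyFun (P i) ξ :=
  map_sum _ _ _

theorem polyFun_X (i : Fin 3) (ξ : E3) : polyFun (X i) ξ = ξ i := eval_X _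

theorem polyFun_zero (ξ : E3) : polyFun 0 ξ = 0 := map_zero _

theorem eq_sum_smul_single (ξ : E3) : ξ = ∑ i, ξ i • EuclideanSpace.single i (1 : ℝ) := by
  ext j
  simp [Fin.sum_univ_three]
  fin_cases j <;> simp

theorem contDiff_polyFun (P : Poly3) {n : WithTop ℕ∞} : ContDiff ℝ n (polyFun P) := by
  induction P using MvPolynomial.induction_on with
  | C a =>
    rw [show polyFun (C a) = fun _ => a from funext fun _ => eval_C _]
    exact contDiff_const
  | add p q hp hq =>
    rw [show polyFun (p + q) = fun ξ => polyFun p ξ + polyFun q ξ from funext (polyFun_add p q)]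
    exact hp.add hq
  | mul_X p i hp =>
    rw [show polyFun (p * X i) = fun ξ => polyFun p ξ * ξ i from
      funext fun ξ => by rw [polyFun_mul, polyFun_X]]
    exact hp.mul (contDiff_piLp_apply 2)

theorem fderiv_coord_apply (i : Fin 3) (ξ u : E3) : fderiv ℝ (fun ξ : E3 => ξ i) ξ u = u i := by
  rw [show (fun ξ : E3 => ξ i) = EuclideanSpace.proj (𝕜 := ℝ) i from rfl,
    ContinuousLinearMap.fderiv]
  rfl

theorem differentiable_coord (i : Fin 3) : Differentiable ℝ (fun ξ : E3 => ξ i) :=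
  (EuclideanSpace.proj (𝕜 := ℝ) i : E3 →L[ℝ] ℝ).differentiable

theorem fderiv_polyFun_apply (P : Poly3) (ξ u : E3) :
    fderiv ℝ (polyFun P) ξ u = ∑ i, u i * polyFun (pderiv i P) ξ := by
  have hd (P : Poly3) : Differentiable ℝ (polyFun P) :=
    (contDiff_polyFun P (n := 1)).differentiable one_ne_zero
  induction P using MvPolynomial.induction_on with
  | C a =>
    rw [show polyFun (C a) = fun _ => a from funext fun _ => eval_C _]
    simp [polyFun_zero]
  | add p q hp hq =>
    rw [show polyFun (p + q) = fun ξ => polyFun p ξ + polyFun q ξ from funext (polyFun_add p q),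
      fderiv_fun_add (hd p ξ) (hd q ξ)]
    simp [hp, hq, polyFun_add, mul_add, Finset.sum_add_distrib]
  | mul_X p i hp =>
    rw [show polyFun (p * X i) = fun ξ => polyFun p ξ * ξ i from
      funext fun ξ => by rw [polyFun_mul, polyFun_X],
      fderiv_fun_mul (hd p ξ) (differentiable_coord i ξ)]
    simp only [add_apply, smul_apply, hp,
      fderiv_coord_apply, smul_eq_mul, pderiv_mul, polyFun_add, polyFun_mul, polyFun_X, mul_add,
      Finset.sum_add_distrib, Finset.mul_sum]
    rw [add_comm]
    congr 1
    · exact Finset.sum_congr rfl fun j _ => by ring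
    · rw [Finset.sum_eq_single i]
      · simp [polyFun]; ring
      · intro j _ hj
        simp [pderiv_X, polyFun, hj.symm]
      · simp

theorem partialDeriv_polyFun (i : Fin 3) (P : Poly3) :
    partialDeriv i (polyFun P) = polyFun (pderiv i P) := by
  ext ξ
  rw [partialDeriv, fderiv_polyFun_apply, Finset.sum_eq_single i] <;> simp +contextual

theorem fderiv_apply_eq_sum_partialDeriv (f : E3 → ℝ) (ξ u : E3) :
    fderiv ℝ f ξ u = ∑ i, u i * partialDeriv i f ξ := by
  conv_lhs => rw [eq_sum_smul_single u]
  simp [partialDeriv]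

theorem contDiff_partialDeriv {f : E3 → ℝ} (hf : ContDiff ℝ ∞ f) (i : Fin 3) :
    ContDiff ℝ ∞ (partialDeriv i f) :=
  (hf.fderiv_right (m := ∞) (by simp)).clm_apply contDiff_const

theorem partialDeriv_comm {f : E3 → ℝ} (hf : ContDiff ℝ ∞ f) (i j : Fin 3) :
    partialDeriv i (partialDeriv j f) = partialDeriv j (partialDeriv i f) := by
  have key (i j : Fin 3) (ξ : E3) : partialDeriv i (partialDeriv j f) ξ =
      fderiv ℝ (fderiv ℝ f) ξ (EuclideanSpace.single i 1) (EuclideanSpace.single j 1) := by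
    have hd : DifferentiableAt ℝ (fderiv ℝ f) ξ :=
      (hf.fderiv_right (m := 1) (by norm_cast)).differentiable one_ne_zero ξ
    change fderiv ℝ (fun ξ => fderiv ℝ f ξ (EuclideanSpace.single j 1)) ξ _ = _
    rw [fderiv_clm_apply hd (differentiableAt_const _)]
    simp
  ext ξ
  rw [key, key]
  exact (hf.contDiffAt.isSymmSndFDerivAt
    (by simpa using WithTop.coe_le_coe.2 (le_top : (2 : ℕ∞) ≤ ⊤))).eq _ _

theorem partialDeriv_sub {f g : E3 → ℝ} (hf : ContDiff ℝ ∞ f) (hg : ContDiff ℝ ∞ g) (i : Fin 3) :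
    partialDeriv i (fun ξ => f ξ - g ξ) = fun ξ => partialDeriv i f ξ - partialDeriv i g ξ := by
  ext ξ
  rw [partialDeriv, fderiv_fun_sub (hf.differentiable (by simp) ξ) (hg.differentiable (by simp) ξ)]
  rfl

/-- If a function vanishes at `0` and its derivative is `O(|ξ|ⁿ)`, then it is `O(|ξ|ⁿ⁺¹)`. -/
theorem isBigO_norm_pow_succ_of_fderiv {E F : Type*} [NormedAddCommGroup E] [NormedSpace ℝ E]
    [NormedAddCommGroup F] [NormedSpace ℝ F] {f : E → F} (hf : Differentiable ℝ f) (h0 : f 0 = 0)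
    {n : ℕ} (h : fderiv ℝ f =O[𝓝 0] fun ξ => ‖ξ‖ ^ n) : f =O[𝓝 0] fun ξ => ‖ξ‖ ^ (n + 1) := by
  obtain ⟨C, hC, hb⟩ := h.exists_pos
  rw [IsBigOWith_def, Metric.eventually_nhds_iff_ball] at hb
  obtain ⟨ε, hε, hb⟩ := hb
  refine IsBigO.of_bound C ?_
  filter_upwards [Metric.ball_mem_nhds _ hε] with ξ hξ
  have hsub : ∀ η ∈ Metric.closedBall (0 : E) ‖ξ‖, ‖fderiv ℝ f η‖ ≤ C * ‖ξ‖ ^ n := by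
    intro η hη
    rw [mem_closedBall_zero_iff] at hη
    refine (hb η (mem_ball_zero_iff.2 (hη.trans_lt (mem_ball_zero_iff.1 hξ)))).trans ?_
    rw [norm_pow, norm_norm]
    gcongr
  have := (convex_closedBall (0 : E) ‖ξ‖).norm_image_sub_le_of_norm_fderiv_le
    (fun η _ => hf η) hsub (x := 0) (y := ξ) (by simp) (by simp)
  rw [h0, sub_zero, sub_zero] at this
  rw [norm_pow, norm_norm, pow_succ, ← mul_assoc]
  exact this

theorem fderiv_isBigO {f : E3 → ℝ} {g : E3 → ℝ}
    (h : ∀ i, partialDeriv i f =O[𝓝 0] g) : fderiv ℝ f =O[𝓝 0] g := by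
  have e : fderiv ℝ f = fun ξ => ∑ i, partialDeriv i f ξ • (EuclideanSpace.proj i : E3 →L[ℝ] ℝ) := by
    ext ξ u
    rw [fderiv_apply_eq_sum_partialDeriv]
    simp [mul_comm]
  rw [e]
  refine IsBigO.fun_sum fun i _ => ?_
  refine IsBigO.trans ?_ (h i)
  refine IsBigO.of_bound ‖(EuclideanSpace.proj i : E3 →L[ℝ] ℝ)‖ (Eventually.of_forall fun ξ => ?_)
  rw [norm_smul, mul_comm]

theorem IsHomogeneous.eval_smul {σ : Type*} {P : MvPolynomial σ ℝ} {n : ℕ}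
    (hP : P.IsHomogeneous n) (t : ℝ) (x : σ → ℝ) : eval (t • x) P = t ^ n * eval x P := by
  rw [eval_eq, eval_eq, Finset.mul_sum]
  refine Finset.sum_congr rfl fun d hd => ?_
  have : ∑ i ∈ d.support, d i = n := by
    have h : d.degree = n := by
      by_contra h
      exact (mem_support_iff.1 hd) (hP.coeff_eq_zero h)
    exact h
  simp only [Pi.smul_apply, smul_eq_mul, mul_pow, Finset.prod_mul_distrib,
    Finset.prod_pow_eq_pow_sum, this]
  ring

/-- A homogeneous polynomial of degree `n` that is `O(|ξ|ⁿ⁺¹)` vanishes. -/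
theorem eq_zero_of_isBigO {P : Poly3} {n : ℕ} (hP : P.IsHomogeneous n)
    (h : polyFun P =O[𝓝 0] fun ξ => ‖ξ‖ ^ (n + 1)) : P = 0 := by
  refine MvPolynomial.funext fun x => ?_
  rw [map_zero]
  set ξ : E3 := WithLp.toLp 2 x with hξ
  have hscale (t : ℝ) : polyFun P (t • ξ) = t ^ n * eval x P := by
    have : (fun i => (t • ξ) i) = t • x := by ext i; simp [hξ]
    rw [polyFun, this, IsHomogeneous.eval_smul hP]
  have htend : Tendsto (fun t : ℝ => t • ξ) (𝓝 0) (𝓝 0) := by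
    have : Continuous fun t : ℝ => t • ξ := by fun_prop
    simpa using this.tendsto 0
  obtain ⟨C, hC⟩ := (h.comp_tendsto htend).bound
  have h1 : ∀ᶠ t : ℝ in 𝓝[>] 0, ‖eval x P‖ ≤ t * (C * ‖ξ‖ ^ (n + 1)) := by
    filter_upwards [nhdsWithin_le_nhds hC, self_mem_nhdsWithin] with t ht htpos
    have htp : (0 : ℝ) < t := htpos
    simp only [Function.comp_apply, hscale, norm_mul, norm_pow, norm_smul, Real.norm_eq_abs,
      abs_of_pos htp, abs_norm, mul_pow] at ht
    have hp : 0 < t ^ n := pow_pos htp n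
    rw [Real.norm_eq_abs]
    refine le_of_mul_le_mul_left ?_ hp
    calc _ ≤ _ := ht
      _ = _ := by ring
  have h2 : Tendsto (fun t : ℝ => t * (C * ‖ξ‖ ^ (n + 1))) (𝓝[>] 0) (𝓝 0) := by
    have : Continuous fun t : ℝ => t * (C * ‖ξ‖ ^ (n + 1)) := by fun_prop
    simpa using (this.tendsto 0).mono_left nhdsWithin_le_nhds
  exact norm_le_zero_iff.1 (ge_of_tendsto h2 h1)

/-- `f` is flat to order `n` at the origin if all its iterated partial derivatives of order less
than `n` vanish there. -/
def FlatAtZero : ℕ → (E3 → ℝ) → Prop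
  | 0, _ => True
  | n + 1, f => f 0 = 0 ∧ ∀ i, FlatAtZero n (partialDeriv i f)

theorem FlatAtZero.isBigO {n : ℕ} {f : E3 → ℝ} (hf : ContDiff ℝ ∞ f) (h : FlatAtZero n f) :
    f =O[𝓝 0] fun ξ => ‖ξ‖ ^ n := by
  induction n generalizing f with
  | zero => simpa using hf.continuous.continuousAt.isBigO_one ℝ
  | succ n ih =>
    exact isBigO_norm_pow_succ_of_fderiv (hf.differentiable (by simp)) h.1
      (fderiv_isBigO fun i => ih (contDiff_partialDeriv hf i) (h.2 i))

theorem isBigO_norm_pow_mono {m n : ℕ} (h : m ≤ n) :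
    (fun ξ : E3 => ‖ξ‖ ^ n) =O[𝓝 0] fun ξ => ‖ξ‖ ^ m := by
  refine IsBigO.of_bound 1 ?_
  filter_upwards [Metric.closedBall_mem_nhds (0 : E3) one_pos] with ξ hξ
  rw [norm_pow, norm_pow, norm_norm, one_mul]
  exact pow_le_pow_of_le_one (norm_nonneg _) (mem_closedBall_zero_iff.1 hξ) h

/-- The leading Taylor polynomial of a function flat to order `n`. Its partial derivatives are the
leading Taylor polynomials of the partial derivatives of `f`, so Euler's identity reconstructs it
from these. -/
theorem FlatAtZero.exists_homogeneous {n : ℕ} {f : E3 → ℝ} (hf : ContDiff ℝ ∞ f)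
    (h : FlatAtZero n f) : ∃ H : Poly3, H.IsHomogeneous n ∧
      FlatAtZero (n + 1) (fun ξ => f ξ - polyFun H ξ) := by
  induction n generalizing f with
  | zero =>
    exact ⟨C (f 0), isHomogeneous_C _ _, by simp [polyFun], fun _ => trivial⟩
  | succ n ih =>
    choose H hH hflat using fun i => ih (contDiff_partialDeriv hf i) (h.2 i)
    have hcomm (i j : Fin 3) : pderiv i (H j) = pderiv j (H i) := by
      cases n with
      | zero =>
        have h0 (i j : Fin 3) : pderiv i (H j) = 0 := by
          rw [totalDegree_eq_zero_iff_eq_C.1 ((totalDegree_zero_iff_isHomogeneous _).2 (hH j))]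
          exact pderiv_C
        rw [h0, h0]
      | succ n =>
        have hp (i j : Fin 3) : (pderiv i (H j)).IsHomogeneous n := by
          simpa using (hH j).pderiv (i := i)
        have hO (i j : Fin 3) : (fun ξ => partialDeriv i (partialDeriv j f) ξ -
            polyFun (pderiv i (H j)) ξ) =O[𝓝 0] fun ξ => ‖ξ‖ ^ (n + 1) := by
          have := (hflat j).2 i
          rw [partialDeriv_sub (contDiff_partialDeriv hf j) (contDiff_polyFun _),
            partialDeriv_polyFun] at this
          exact this.isBigO ((contDiff_partialDeriv (contDiff_partialDeriv hf j) i).sub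
            (contDiff_polyFun _))
        refine sub_eq_zero.1 (eq_zero_of_isBigO ((hp i j).sub (hp j i)) ?_)
        refine ((hO j i).sub (hO i j)).congr_left fun ξ => ?_
        rw [polyFun_sub, partialDeriv_comm hf j i]
        ring
    set P : Poly3 := ((n + 1 : ℕ) : ℝ)⁻¹ • ∑ i, X i * H i with hP
    have hder (j : Fin 3) : pderiv j P = H j := by
      have h0 : ((n + 1 : ℕ) : ℝ) ≠ 0 := by positivity
      have euler := (hH j).sum_X_mul_pderiv
      rw [hP, Derivation.map_smul, inv_smul_eq_iff₀ h0, Nat.cast_smul_eq_nsmul, succ_nsmul,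
        ← euler, map_sum]
      simp only [pderiv_mul, Finset.sum_add_distrib, hcomm j]
      rw [add_comm]
      congr 1
      simp [pderiv_X, Pi.single_apply]
    refine ⟨P, ?_, ?_, fun i => ?_⟩
    · refine IsHomogeneous.const_smul (IsHomogeneous.sum _ _ _ fun i _ => ?_) _
      rw [add_comm]
      exact (isHomogeneous_X ℝ i).mul (hH i)
    · change f 0 - polyFun P 0 = 0
      rw [h.1, hP, polyFun_smul, polyFun_sum]
      simp [polyFun_mul, polyFun_X]
    · rw [partialDeriv_sub hf (contDiff_polyFun _), partialDeriv_polyFun, hder]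
      exact hflat i

theorem flatAtZero_of_isBigO {n : ℕ} {f : E3 → ℝ} (hf : ContDiff ℝ ∞ f)
    (h : f =O[𝓝 0] fun ξ => ‖ξ‖ ^ n) : FlatAtZero n f := by
  induction n with
  | zero => trivial
  | succ n ih =>
    obtain ⟨H, hH, hflat⟩ :=
      FlatAtZero.exists_homogeneous hf (ih (h.trans (isBigO_norm_pow_mono n.le_succ)))
    have hO := hflat.isBigO (hf.sub (contDiff_polyFun _))
    have : H = 0 := by
      refine eq_zero_of_isBigO hH ((h.sub hO).congr_left fun ξ => ?_)
      ring
    simpa [this, polyFun_zero] using hflat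

/-- The next term of the Taylor expansion of a smooth function. -/
theorem exists_homogeneous_isBigO {n : ℕ} {f : E3 → ℝ} (hf : ContDiff ℝ ∞ f)
    (h : f =O[𝓝 0] fun ξ => ‖ξ‖ ^ n) : ∃ H : Poly3, H.IsHomogeneous n ∧
      (fun ξ => f ξ - polyFun H ξ) =O[𝓝 0] fun ξ => ‖ξ‖ ^ (n + 1) := by
  obtain ⟨H, hH, hflat⟩ := (flatAtZero_of_isBigO hf h).exists_homogeneous hf
  exact ⟨H, hH, hflat.isBigO (hf.sub (contDiff_polyFun _))⟩

theorem partialDeriv_isBigO {n : ℕ} {f : E3 → ℝ} (hf : ContDiff ℝ ∞ f)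
    (h : f =O[𝓝 0] fun ξ => ‖ξ‖ ^ (n + 1)) (i : Fin 3) :
    partialDeriv i f =O[𝓝 0] fun ξ => ‖ξ‖ ^ n :=
  ((flatAtZero_of_isBigO hf h).2 i).isBigO (contDiff_partialDeriv hf i)

theorem polyFun_isBigO {P : Poly3} {n : ℕ} (hP : P.IsHomogeneous n) :
    polyFun P =O[𝓝 0] fun ξ => ‖ξ‖ ^ n := by
  rw [show polyFun P = fun ξ => ∑ d ∈ P.support, coeff d P * ∏ i, ξ i ^ d i from
    funext fun ξ => eval_eq' _ _]
  refine IsBigO.fun_sum fun d hd => IsBigO.of_bound |coeff d P| (Eventually.of_forall fun ξ => ?_)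
  have hdn : ∑ i, d i = n := by
    rw [← Finsupp.degree_eq_sum]
    by_contra h
    exact (mem_support_iff.1 hd) (hP.coeff_eq_zero h)
  rw [norm_mul, norm_prod, norm_pow, norm_norm, ← hdn, ← Finset.prod_pow_eq_pow_sum]
  refine mul_le_mul_of_nonneg_left (Finset.prod_le_prod (fun _ _ => norm_nonneg _) fun i _ => ?_)
    (abs_nonneg _)
  rw [norm_pow]
  exact pow_le_pow_left₀ (norm_nonneg _) (PiLp.norm_apply_le ξ i) _

/-! ### Volume-preserving conjugacy of vector fields -/

/-- `v` can be transformed into `w` by a volume-preserving, near-identity diffeomorphism. -/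
def VolumeConjugate (v w : E3 → E3) : Prop :=
  ∃ ψ : Diffeomorph 𝓘(ℝ, E3) 𝓘(ℝ, E3) E3 E3 ∞,
    IsVolumePreserving ψ ∧ IsNearIdentity ψ ∧ Conjugates ψ v w

theorem VolumeConjugate.refl (v : E3 → E3) : VolumeConjugate v v := by
  refine ⟨Diffeomorph.refl _ _ _, fun ξ => ?_, ?_, fun ξ => ?_⟩
  · simp [ContinuousLinearMap.det]
  · simpa [IsNearIdentity] using isBigO_zero _ _
  · simp

theorem IsNearIdentity.isBigO_id {ψ : E3 → E3} (h : IsNearIdentity ψ) :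
    ψ =O[𝓝 0] fun ξ => ‖ξ‖ := by
  have h1 : (fun ξ => ψ ξ - ξ) =O[𝓝 0] fun ξ : E3 => ‖ξ‖ := by
    simpa using h.trans (isBigO_norm_pow_mono (m := 1) one_le_two)
  have h2 : (fun ξ : E3 => ξ) =O[𝓝 0] fun ξ : E3 => ‖ξ‖ := (isBigO_refl _ _).norm_right
  simpa using h1.add h2

theorem VolumeConjugate.trans {u v w : E3 → E3} (h₁ : VolumeConjugate u v)
    (h₂ : VolumeConjugate v w) : VolumeConjugate u w := by
  obtain ⟨φ, hφ, hφ', hφ''⟩ := h₁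
  obtain ⟨ψ, hψ, hψ', hψ''⟩ := h₂
  have hd (χ : Diffeomorph 𝓘(ℝ, E3) 𝓘(ℝ, E3) E3 E3 ∞) : Differentiable ℝ χ :=
    χ.contMDiff_toFun.contDiff.differentiable (by simp)
  have hc (ξ : E3) : fderiv ℝ (φ.trans ψ) ξ = (fderiv ℝ ψ (φ ξ)).comp (fderiv ℝ φ ξ) :=
    fderiv_comp ξ (hd ψ _) (hd φ _)
  refine ⟨φ.trans ψ, fun ξ => ?_, ?_, fun ξ => ?_⟩
  · have h1 := hφ ξ
    have h2 := hψ (φ ξ)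
    rw [ContinuousLinearMap.det] at h1 h2
    rw [hc, ContinuousLinearMap.det]
    exact (LinearMap.det_comp _ _).trans (by rw [h1, h2, one_mul])
  · have ht : Tendsto φ (𝓝 0) (𝓝 0) :=
      hφ'.isBigO_id.trans_tendsto (tendsto_norm_zero)
    have h1 : (fun ξ => ψ (φ ξ) - φ ξ) =O[𝓝 0] fun ξ : E3 => ‖ξ‖ ^ 2 :=
      (hψ'.comp_tendsto ht).trans (hφ'.isBigO_id.norm_left.pow 2)
    refine (h1.add hφ').congr_left fun ξ => ?_
    simp
  · rw [hc]
    change fderiv ℝ ψ (φ ξ) (fderiv ℝ φ ξ (u ξ)) = _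
    rw [hφ'', hψ'']
    rfl

/-- Smooth divergence-free vector fields with an equilibrium at the origin whose linear part is
`N`. -/
structure IsNilpotentDivFree (v : E3 → E3) : Prop where
  contDiff : ContDiff ℝ ∞ v
  divergence_eq_zero : ∀ ξ, divergence v ξ = 0
  isBigO_sub_linN : (fun ξ => v ξ - linN ξ) =O[𝓝 0] fun ξ => ‖ξ‖ ^ 2

theorem linN_apply (ξ : E3) : linN ξ = !₂[ξ 1, ξ 2, 0] := by
  ext i
  fin_cases i <;> simp [linN, jordanN, Matrix.vecHead, Matrix.vecTail]

theorem isBigO_of_forall_apply {f : E3 → E3} {g : E3 → ℝ}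
    (h : ∀ i, (fun ξ => f ξ i) =O[𝓝 0] g) : f =O[𝓝 0] g := by
  have e : f = fun ξ => ∑ i, f ξ i • EuclideanSpace.single i (1 : ℝ) :=
    funext fun ξ => eq_sum_smul_single _
  rw [e]
  refine IsBigO.fun_sum fun i _ => IsBigO.trans ?_ (h i)
  refine IsBigO.of_bound 1 (Eventually.of_forall fun ξ => ?_)
  rw [norm_smul]
  simp

theorem IsBigO.apply {f : E3 → E3} {g : E3 → ℝ} (h : f =O[𝓝 0] g) (i : Fin 3) :
    (fun ξ => f ξ i) =O[𝓝 0] g :=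
  (isBigO_of_le _ fun ξ => PiLp.norm_apply_le (f ξ) i).trans h

/-! ### Transforming a vector field by a shear -/

/-- The transform of `v` by the shear `ξ ↦ ξ + q(ξ) d`. -/
def shearTransform (q : E3 → ℝ) (d : E3) (v : E3 → E3) (η : E3) : E3 :=
  v (η - q η • d) + fderiv ℝ q η (v (η - q η • d)) • d

section Shear

variable {q : E3 → ℝ} {d : E3}

theorem apply_add_smul_of_fderiv_eq_zero (hq : ContDiff ℝ ∞ q) (hd : ∀ ξ, fderiv ℝ q ξ d = 0)
    (ξ : E3) (t : ℝ) : q (ξ + t • d) = q ξ := by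
  have hder (t : ℝ) : HasDerivAt (fun t : ℝ => q (ξ + t • d)) 0 t := by
    have h1 : HasDerivAt (fun t : ℝ => ξ + t • d) d t := by
      simpa using ((hasDerivAt_id t).smul_const d).const_add ξ
    have h2 := (hq.differentiable (by simp) (ξ + t • d)).hasFDerivAt.comp_hasDerivAt t h1
    rwa [hd] at h2
  have := is_const_of_deriv_eq_zero (fun t => (hder t).differentiableAt) (fun t => (hder t).deriv)
    t 0
  simpa using this

theorem fderiv_add_smul_of_fderiv_eq_zero (hq : ContDiff ℝ ∞ q) (hd : ∀ ξ, fderiv ℝ q ξ d = 0)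
    (ξ : E3) (t : ℝ) : fderiv ℝ q (ξ + t • d) = fderiv ℝ q ξ := by
  rw [← fderiv_comp_add_right]
  congr 1
  ext ξ
  exact apply_add_smul_of_fderiv_eq_zero hq hd ξ t

/-- The shear `ξ ↦ ξ + q(ξ) d`, where `q` is constant along `d`; its inverse is `η ↦ η - q(η) d`. -/
def shearDiffeo (hq : ContDiff ℝ ∞ q) (hd : ∀ ξ, fderiv ℝ q ξ d = 0) :
    Diffeomorph 𝓘(ℝ, E3) 𝓘(ℝ, E3) E3 E3 ∞ where
  toFun ξ := ξ + q ξ • d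
  invFun η := η - q η • d
  left_inv ξ := by
    simp only [apply_add_smul_of_fderiv_eq_zero hq hd, add_sub_cancel_right]
  right_inv η := by
    have := apply_add_smul_of_fderiv_eq_zero hq hd η (-q η)
    rw [neg_smul, ← sub_eq_add_neg] at this
    simp only [this, sub_add_cancel]
  contMDiff_toFun := (contDiff_id.add (hq.smul contDiff_const)).contMDiff
  contMDiff_invFun := (contDiff_id.sub (hq.smul contDiff_const)).contMDiff

theorem fderiv_shearDiffeo (hq : ContDiff ℝ ∞ q) (hd : ∀ ξ, fderiv ℝ q ξ d = 0) (ξ : E3) :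
    fderiv ℝ (shearDiffeo hq hd) ξ =
      ContinuousLinearMap.id ℝ E3 + (fderiv ℝ q ξ).smulRight d :=
  ((hasFDerivAt_id ξ).add
    ((hq.differentiable (by simp) ξ).hasFDerivAt.smul_const d)).fderiv

theorem volumeConjugate_shearTransform (hq : ContDiff ℝ ∞ q) (hd : ∀ ξ, fderiv ℝ q ξ d = 0)
    (hO : q =O[𝓝 0] fun ξ => ‖ξ‖ ^ 2) (v : E3 → E3) :
    VolumeConjugate v (shearTransform q d v) := by
  refine ⟨shearDiffeo hq hd, fun ξ => ?_, ?_, fun ξ => ?_⟩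
  · rw [fderiv_shearDiffeo, ContinuousLinearMap.det]
    have := LinearMap.transvection.det (fderiv ℝ q ξ : E3 →ₗ[ℝ] ℝ) d
    have e : (↑(ContinuousLinearMap.id ℝ E3 + (fderiv ℝ q ξ).smulRight d) : E3 →ₗ[ℝ] E3) =
        LinearMap.transvection (fderiv ℝ q ξ : E3 →ₗ[ℝ] ℝ) d := by
      ext1 u
      simp [LinearMap.transvection.apply]
    rw [e, this]
    simp [hd]
  · have : (fun ξ => q ξ • d) =O[𝓝 0] fun ξ : E3 => ‖ξ‖ ^ 2 := by
      simpa using hO.smul (isBigO_const_const d (one_ne_zero' ℝ) (𝓝 (0 : E3)))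
    refine this.congr_left fun ξ => ?_
    change q ξ • d = ξ + q ξ • d - ξ
    rw [add_sub_cancel_left]
  · rw [fderiv_shearDiffeo]
    change v ξ + fderiv ℝ q ξ (v ξ) • d = shearTransform q d v (ξ + q ξ • d)
    rw [shearTransform, apply_add_smul_of_fderiv_eq_zero hq hd, add_sub_cancel_right,
      fderiv_add_smul_of_fderiv_eq_zero hq hd]

theorem contDiff_shearTransform (hq : ContDiff ℝ ∞ q) {v : E3 → E3} (hv : ContDiff ℝ ∞ v) :
    ContDiff ℝ ∞ (shearTransform q d v) := by
  have h1 : ContDiff ℝ ∞ fun η => v (η - q η • d) :=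
    hv.comp (contDiff_id.sub (hq.smul contDiff_const))
  exact h1.add (((hq.fderiv_right (m := ∞) (by simp)).clm_apply h1).smul contDiff_const)

theorem sum_apply_single_mul (f : E3 →L[ℝ] ℝ) (x : E3) :
    ∑ i, f (EuclideanSpace.single i 1) * x i = f x := by
  conv_rhs => rw [eq_sum_smul_single x]
  simp [mul_comm]

/-- Differentiating `shearTransform` produces, besides `div v`, only terms that cancel because
`q` and `Dq` are constant along `d`. -/
theorem divergence_shearTransform (hq : ContDiff ℝ ∞ q) (hd : ∀ ξ, fderiv ℝ q ξ d = 0)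
    {v : E3 → E3} (hv : ContDiff ℝ ∞ v) (η : E3) :
    divergence (shearTransform q d v) η = divergence v (η - q η • d) := by
  have hq1 : HasFDerivAt q (fderiv ℝ q η) η := (hq.differentiable (by simp) η).hasFDerivAt
  have hq2 : HasFDerivAt (fderiv ℝ q) (fderiv ℝ (fderiv ℝ q) η) η :=
    ((hq.fderiv_right (m := ∞) (by simp)).differentiable (by simp) η).hasFDerivAt
  have hσ : HasFDerivAt (fun η => η - q η • d)
      (ContinuousLinearMap.id ℝ E3 - (fderiv ℝ q η).smulRight d) η :=
    (hasFDerivAt_id η).sub (hq1.smul_const d)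
  set A := fderiv ℝ v (η - q η • d) with hA
  have hu := ((hv.differentiable (by simp) (η - q η • d)).hasFDerivAt.comp η hσ)
  rw [← hA] at hu
  have hφ := hq2.clm_apply hu
  have hw := hu.add (hφ.smul_const d)
  have hflat : fderiv ℝ (fderiv ℝ q) η d = 0 := by
    have h1 : HasDerivAt (fun t : ℝ => η + t • d) d 0 := by
      simpa using ((hasDerivAt_id (0 : ℝ)).smul_const d).const_add η
    have h2 : HasFDerivAt (fderiv ℝ q) (fderiv ℝ (fderiv ℝ q) η) (η + (0 : ℝ) • d) := by
      simpa using hq2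
    have h3 := h2.comp_hasDerivAt 0 h1
    have e : fderiv ℝ q ∘ (fun t : ℝ => η + t • d) = fun _ => fderiv ℝ q η :=
      funext fun t => fderiv_add_smul_of_fderiv_eq_zero hq hd η t
    rw [e] at h3
    exact h3.unique (hasDerivAt_const _ _)
  have hw' := hw.fderiv
  change fderiv ℝ (shearTransform q d v) η = _ at hw'
  rw [divergence, hw', divergence, ← hA]
  set Φ := (fderiv ℝ q η).comp (A.comp (ContinuousLinearMap.id ℝ E3 -
    (fderiv ℝ q η).smulRight d)) + (fderiv ℝ (fderiv ℝ q) η).flip (v (η - q η • d)) with hΦ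
  have hΦd : Φ d = fderiv ℝ q η (A d) := by
    simp [hΦ, hflat, hd]
  have h1 := sum_apply_single_mul Φ d
  have h2 := sum_apply_single_mul (fderiv ℝ q η) (A d)
  have h3 (i : Fin 3) : ((A.comp (ContinuousLinearMap.id ℝ E3 - (fderiv ℝ q η).smulRight d) +
      Φ.smulRight d) (EuclideanSpace.single i 1)) i =
      (A (EuclideanSpace.single i 1)) i -
        fderiv ℝ q η (EuclideanSpace.single i 1) * (A d) i +
        Φ (EuclideanSpace.single i 1) * d i := by
    simp
  calc _ = ∑ i, ((A (EuclideanSpace.single i 1)) i -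
        fderiv ℝ q η (EuclideanSpace.single i 1) * (A d) i +
        Φ (EuclideanSpace.single i 1) * d i) := Finset.sum_congr rfl fun i _ => h3 i
    _ = _ := by
      rw [Finset.sum_add_distrib, Finset.sum_sub_distrib, h1, h2, hΦd, sub_add_cancel]

end Shear

/-- If `DR = O(|ξ|)` and `δ(η) = O(|η|ᵐ)`, then `R(η + δ(η)) - R(η) = O(|η|ᵐ⁺¹)`. -/
theorem isBigO_comp_add_sub {R δ : E3 → E3} (hR : Differentiable ℝ R)
    (hDR : fderiv ℝ R =O[𝓝 0] fun ξ => ‖ξ‖) {m : ℕ} (hm : 1 ≤ m)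
    (hδ : δ =O[𝓝 0] fun ξ => ‖ξ‖ ^ m) :
    (fun η => R (η + δ η) - R η) =O[𝓝 0] fun η => ‖η‖ ^ (m + 1) := by
  obtain ⟨C, hC, hb⟩ := hDR.exists_pos
  rw [IsBigOWith_def, Metric.eventually_nhds_iff_ball] at hb
  obtain ⟨ε, hε, hb⟩ := hb
  obtain ⟨K, hK, hδK⟩ := hδ.exists_pos
  rw [IsBigOWith_def] at hδK
  refine IsBigO.of_bound (C * (1 + K) * K) ?_
  have hr : 0 < min 1 (ε / (1 + K)) := by positivity
  filter_upwards [hδK, Metric.ball_mem_nhds _ hr] with η hη hball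
  rw [mem_ball_zero_iff, lt_min_iff, lt_div_iff₀ (by positivity)] at hball
  rw [norm_pow, norm_norm] at hη ⊢
  have hη1 : ‖η‖ ^ m ≤ ‖η‖ := pow_le_of_le_one (norm_nonneg _) hball.1.le (by omega)
  have hρ : ‖η‖ ≤ (1 + K) * ‖η‖ := by nlinarith [norm_nonneg η]
  have hρ' : ‖η + δ η‖ ≤ (1 + K) * ‖η‖ := by
    have := mul_le_mul_of_nonneg_left hη1 hK.le
    linarith [norm_add_le η (δ η)]
  have hsub : ∀ ζ ∈ Metric.closedBall (0 : E3) ((1 + K) * ‖η‖),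
      ‖fderiv ℝ R ζ‖ ≤ C * ((1 + K) * ‖η‖) := by
    intro ζ hζ
    rw [mem_closedBall_zero_iff] at hζ
    refine (hb ζ (mem_ball_zero_iff.2 (by linarith))).trans ?_
    rw [norm_norm]
    gcongr
  have := (convex_closedBall (0 : E3) ((1 + K) * ‖η‖)).norm_image_sub_le_of_norm_fderiv_le
    (fun η _ => hR η) hsub (mem_closedBall_zero_iff.2 hρ) (mem_closedBall_zero_iff.2 hρ')
  rw [add_sub_cancel_left] at this
  calc _ ≤ _ := this
    _ ≤ C * ((1 + K) * ‖η‖) * (K * ‖η‖ ^ m) := by gcongr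
    _ = _ := by ring

/-- The vector field with polynomial components `h`. -/
def polyField (h : Fin 3 → Poly3) (ξ : E3) : E3 := WithLp.toLp 2 fun i => polyFun (h i) ξ

/-- The Lie bracket `Dh(ξ) N ξ - N h(ξ)` of polynomial fields. -/
def lieBracketN (h : Fin 3 → Poly3) : Fin 3 → Poly3 :=
  fun i => lieN (h i) - ![h 1, h 2, 0] i

theorem isHomogeneous_lieBracketN {h : Fin 3 → Poly3} {m : ℕ} (hm : m ≠ 0)
    (hh : ∀ i, (h i).IsHomogeneous m) (i : Fin 3) : (lieBracketN h i).IsHomogeneous m := by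
  refine (isHomogeneous_lieN hm (hh i)).sub ?_
  fin_cases i
  exacts [hh 1, hh 2, isHomogeneous_zero _ _ _]

theorem polyField_isBigO {h : Fin 3 → Poly3} {m : ℕ} (hh : ∀ i, (h i).IsHomogeneous m) :
    polyField h =O[𝓝 0] fun ξ => ‖ξ‖ ^ m :=
  isBigO_of_forall_apply fun i => polyFun_isBigO (hh i)

/-- A homogeneous shear field `h` of degree `m` changes a field with linear part `N` by
`[h, N]` to leading order. -/
theorem exists_volumeConjugate_of_mem_shearFields {m : ℕ} (hm : 2 ≤ m) {h : Fin 3 → Poly3}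
    (hh : h ∈ shearFields m) {v : E3 → E3} (hv : IsNilpotentDivFree v) :
    ∃ w, IsNilpotentDivFree w ∧ VolumeConjugate v w ∧
      (fun η => w η - (v η + polyField (lieBracketN h) η)) =O[𝓝 0] fun η => ‖η‖ ^ (m + 1) := by
  obtain ⟨Q, c, hQ, hQc, rfl⟩ := hh
  set q := polyFun Q with hq_def
  set d : E3 := WithLp.toLp 2 c with hd_def
  have hq : ContDiff ℝ ∞ q := contDiff_polyFun Q
  have hqm : q =O[𝓝 0] fun ξ => ‖ξ‖ ^ m := polyFun_isBigO hQ
  have hd (ξ : E3) : fderiv ℝ q ξ d = 0 := by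
    have := congrArg (fun P => polyFun P ξ) hQc
    simpa [polyFun_sum, polyFun_smul, polyFun_zero, hq_def, fderiv_polyFun_apply] using this
  have hδ : (fun η => -(q η • d)) =O[𝓝 0] fun η : E3 => ‖η‖ ^ m := by
    have := hqm.smul (isBigO_const_const d (one_ne_zero' ℝ) (𝓝 (0 : E3)))
    simpa using this.neg_left
  set R : E3 → E3 := fun ξ => v ξ - linN ξ with hR_def
  have hR : ContDiff ℝ ∞ R := hv.contDiff.sub linN.contDiff
  have hDR : fderiv ℝ R =O[𝓝 0] fun ξ => ‖ξ‖ := by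
    have h0 : fderiv ℝ R 0 = 0 := by
      have : R =O[𝓝 0] fun ξ => ‖ξ - 0‖ ^ 2 := by simpa using hv.isBigO_sub_linN
      exact (this.hasFDerivAt one_lt_two).fderiv
    have h1 := ((hR.fderiv_right (m := ∞) (by simp)).differentiable (by simp) 0).isBigO_sub
    simpa [h0] using h1.norm_right
  have hR1 := isBigO_comp_add_sub (hR.differentiable (by simp)) hDR (by omega) hδ
  have hDq : fderiv ℝ q =O[𝓝 0] fun ξ => ‖ξ‖ ^ (m - 1) :=
    fderiv_isBigO fun i => by
      rw [hq_def, partialDeriv_polyFun]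
      exact polyFun_isBigO hQ.pderiv
  have hx : (fun η => v (η - q η • d) - linN η) =O[𝓝 0] fun η : E3 => ‖η‖ ^ 2 := by
    have h1 := hR1.trans (isBigO_norm_pow_mono (show 2 ≤ m + 1 by omega))
    have h2 := ((linN.isBigO_comp _ _).trans hδ).trans (isBigO_norm_pow_mono hm)
    refine ((h1.add hv.isBigO_sub_linN).add h2).congr_left fun η => ?_
    simp only [hR_def, ← sub_eq_add_neg, map_neg, map_sub]
    abel
  -- `Dq = O(|η|ᵐ⁻¹)`, so replacing `v` by `N η` in the argument of `Dq` costs `O(|η|ᵐ⁺¹)`.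
  have hterm : (fun η => fderiv ℝ q η (v (η - q η • d) - linN η) • d) =O[𝓝 0]
      fun η : E3 => ‖η‖ ^ (m + 1) := by
    have h1 : (fun η => fderiv ℝ q η (v (η - q η • d) - linN η)) =O[𝓝 0]
        fun η : E3 => ‖fderiv ℝ q η‖ * ‖v (η - q η • d) - linN η‖ :=
      isBigO_of_le _ fun η => by
        rw [norm_mul, norm_norm, norm_norm]
        exact (fderiv ℝ q η).le_opNorm _
    have h2 := h1.trans (hDq.norm_left.mul hx.norm_left)
    have h3 := h2.smul (isBigO_const_const d (one_ne_zero' ℝ) (𝓝 (0 : E3)))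
    refine h3.congr_right fun η => ?_
    rw [← pow_add, smul_eq_mul, mul_one]
    congr 1
    omega
  have hbr (η : E3) : polyField (lieBracketN fun i => c i • Q) η =
      fderiv ℝ q η (linN η) • d - linN (q η • d) := by
    have : fderiv ℝ q η (linN η) = polyFun (lieN Q) η := by
      rw [hq_def, fderiv_polyFun_apply, lieN_apply, Fin.sum_univ_three, linN_apply, polyFun_add,
        polyFun_mul, polyFun_mul, polyFun_X, polyFun_X]
      simp
    rw [this, linN_apply]
    ext i
    fin_cases i <;>
      simp [polyField, lieBracketN, polyFun_sub, polyFun_smul, hd_def, polyFun_zero] <;> ring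
  have hmain : (fun η => shearTransform q d v η -
      (v η + polyField (lieBracketN fun i => c i • Q) η)) =O[𝓝 0] fun η => ‖η‖ ^ (m + 1) := by
    refine (hR1.add hterm).congr_left fun η => ?_
    rw [hbr, shearTransform]
    simp only [hR_def, ← sub_eq_add_neg, map_sub, sub_smul]
    abel
  have hfields : ∀ i, (c i • Q).IsHomogeneous m := fun i => IsHomogeneous.const_smul hQ _
  refine ⟨shearTransform q d v, ⟨contDiff_shearTransform hq hv.contDiff, fun η => ?_, ?_⟩,
    volumeConjugate_shearTransform hq hd (hqm.trans (isBigO_norm_pow_mono hm)) v, hmain⟩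
  · rw [divergence_shearTransform hq hd hv.contDiff, hv.divergence_eq_zero]
  · have h1 := hmain.trans (isBigO_norm_pow_mono (show 2 ≤ m + 1 by omega))
    have h2 := (polyField_isBigO (isHomogeneous_lieBracketN (by omega) hfields)).trans
      (isBigO_norm_pow_mono hm)
    refine ((h1.add h2).add hv.isBigO_sub_linN).congr_left fun η => ?_
    abel

/-! ### Normalization degree by degree -/

theorem smul_mem_shearFields {m : ℕ} {h : Fin 3 → Poly3} (hh : h ∈ shearFields m) (r : ℝ) :
    r • h ∈ shearFields m := by
  obtain ⟨q, d, hq, hd, rfl⟩ := hh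
  refine ⟨q, r • d, hq, ?_, ?_⟩
  · simp only [Pi.smul_apply, smul_assoc, ← Finset.smul_sum, hd, smul_zero]
  · ext1 i
    simp [smul_smul]

theorem polyField_lieBracketN_add (g h : Fin 3 → Poly3) (η : E3) :
    polyField (lieBracketN (g + h)) η =
      polyField (lieBracketN g) η + polyField (lieBracketN h) η := by
  ext i
  fin_cases i <;> simp [polyField, lieBracketN, polyFun_sub, polyFun_add, polyFun_zero] <;> ring

theorem polyField_lieBracketN_zero (η : E3) : polyField (lieBracketN 0) η = 0 := by
  ext i
  fin_cases i <;> simp [polyField, lieBracketN, polyFun_zero]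

/-- Composing shears realizes every divergence-free homogeneous field `h` as the leading term of a
volume-preserving diffeomorphism. -/
theorem exists_volumeConjugate_of_polyDiv_eq_zero {m : ℕ} (hm : 2 ≤ m) {h : Fin 3 → Poly3}
    (hh : ∀ i, (h i).IsHomogeneous m) (hdiv : polyDiv h = 0) {v : E3 → E3}
    (hv : IsNilpotentDivFree v) :
    ∃ w, IsNilpotentDivFree w ∧ VolumeConjugate v w ∧
      (fun η => w η - (v η + polyField (lieBracketN h) η)) =O[𝓝 0] fun η => ‖η‖ ^ (m + 1) := by
  have hmem := mem_span_shearFields hh hdiv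
  clear hh hdiv
  induction hmem using Submodule.closure_induction generalizing v with
  | zero =>
    refine ⟨v, hv, VolumeConjugate.refl v, ?_⟩
    simpa [polyField_lieBracketN_zero] using isBigO_zero _ _
  | add g h _ _ hg hh =>
    obtain ⟨w, hw, hvw, hO⟩ := hg hv
    obtain ⟨u, hu, hwu, hO'⟩ := hh hw
    refine ⟨u, hu, hvw.trans hwu, (hO.add hO').congr_left fun η => ?_⟩
    rw [polyField_lieBracketN_add]
    abel
  | smul_mem r h hh =>
    exact exists_volumeConjugate_of_mem_shearFields hm (smul_mem_shearFields hh r) hv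

theorem partialDeriv_apply {v : E3 → E3} (hv : ContDiff ℝ ∞ v) (i : Fin 3) (ξ : E3) :
    partialDeriv i (fun ξ => v ξ i) ξ = (fderiv ℝ v ξ (EuclideanSpace.single i 1)) i := by
  have h := (EuclideanSpace.proj (𝕜 := ℝ) i : E3 →L[ℝ] ℝ).hasFDerivAt.comp ξ
    (hv.differentiable (by simp) ξ).hasFDerivAt
  have h' : fderiv ℝ (fun ξ => v ξ i) ξ = _ := h.fderiv
  rw [partialDeriv, h']
  rfl

/-- The polynomial field underlying `normalForm p`. -/
def normalFormPoly (p : MvPolynomial (Fin 2) ℝ) : Fin 3 → Poly3 :=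
  ![X 1, X 2, rename ![0, 1] p]

theorem polyField_normalFormPoly (p : MvPolynomial (Fin 2) ℝ) (η : E3) :
    polyField (normalFormPoly p) η = normalForm p η := by
  have : (fun i => η i) ∘ (![0, 1] : Fin 2 → Fin 3) = ![η 0, η 1] := by
    ext i; fin_cases i <;> rfl
  rw [normalForm, linN_apply]
  ext i
  fin_cases i <;>
    simp [polyField, normalFormPoly, e₃, polyFun, eval_rename, this]

theorem pderiv_normalFormPoly (p : MvPolynomial (Fin 2) ℝ) (i : Fin 3) :
    pderiv i (normalFormPoly p i) = 0 := by
  fin_cases i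
  · simp [normalFormPoly, pderiv_X]
  · simp [normalFormPoly, pderiv_X]
  · refine pderiv_eq_zero_of_notMem_vars fun h => ?_
    obtain ⟨j, _, hj⟩ := Finset.mem_image.1 (vars_rename _ _ h)
    fin_cases j <;> simp at hj

theorem contDiff_polyField (h : Fin 3 → Poly3) : ContDiff ℝ ∞ (polyField h) :=
  contDiff_euclidean.2 fun i => contDiff_polyFun (h i)

/-- The leading term of `w - normalForm p` is again divergence free. -/
theorem exists_divFree_leading_term {m : ℕ} {w : E3 → E3} (hw : ContDiff ℝ ∞ w)
    (hdiv : ∀ ξ, divergence w ξ = 0) (p : MvPolynomial (Fin 2) ℝ)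
    (hO : (fun η => w η - normalForm p η) =O[𝓝 0] fun η => ‖η‖ ^ (m + 1)) :
    ∃ F : Fin 3 → Poly3, (∀ i, (F i).IsHomogeneous (m + 1)) ∧ polyDiv F = 0 ∧
      (fun η => w η - normalForm p η - polyField F η) =O[𝓝 0] fun η => ‖η‖ ^ (m + 2) := by
  have hcoord (u : E3 → E3) (hu : ContDiff ℝ ∞ u) (i : Fin 3) : ContDiff ℝ ∞ fun ξ => u ξ i :=
    contDiff_euclidean.1 hu i
  have hN : ContDiff ℝ ∞ (normalForm p) := by
    rw [← funext (polyField_normalFormPoly p)]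
    exact contDiff_polyField _
  have hS (i : Fin 3) : ContDiff ℝ ∞ fun ξ => (w ξ - normalForm p ξ) i :=
    hcoord _ (hw.sub hN) i
  choose F hF hFO using fun i => exists_homogeneous_isBigO (hS i) (IsBigO.apply hO i)
  refine ⟨F, hF, ?_, isBigO_of_forall_apply hFO⟩
  have hder (i : Fin 3) : partialDeriv i (fun ξ => (w ξ - normalForm p ξ) i - polyFun (F i) ξ) =
      fun ξ => (fderiv ℝ w ξ (EuclideanSpace.single i 1)) i - polyFun (pderiv i (F i)) ξ := by
    have e : (fun ξ => (normalForm p ξ) i) = polyFun (normalFormPoly p i) := by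
      rw [← funext (polyField_normalFormPoly p)]
      rfl
    rw [partialDeriv_sub (hS i) (contDiff_polyFun _), partialDeriv_polyFun]
    have : partialDeriv i (fun ξ => (w ξ - normalForm p ξ) i) =
        fun ξ => (fderiv ℝ w ξ (EuclideanSpace.single i 1)) i := by
      change partialDeriv i (fun ξ => w ξ i - normalForm p ξ i) = _
      rw [partialDeriv_sub (hcoord w hw i) (hcoord _ hN i), e, partialDeriv_polyFun,
        pderiv_normalFormPoly]
      ext ξ
      rw [partialDeriv_apply hw, polyFun_zero, sub_zero]
    rw [this]
  refine eq_zero_of_isBigO (n := m) (IsHomogeneous.sum _ _ _ fun i _ => ?_) ?_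
  · simpa using (hF i).pderiv (i := i)
  · have hsum := IsBigO.fun_sum (s := Finset.univ) fun i _ =>
      partialDeriv_isBigO ((hS i).sub (contDiff_polyFun (F i))) (hFO i) i
    refine hsum.neg_left.congr_left fun ξ => ?_
    have := hdiv ξ
    rw [divergence] at this
    simp only [hder, Finset.sum_sub_distrib, this, polyDiv, polyFun_sum]
    ring

/-- The polynomial `r(x, y, 0)` in two variables. -/
def dropThird (r : Poly3) : MvPolynomial (Fin 2) ℝ := aeval ![X 0, X 1, 0] r

theorem isHomogeneous_dropThird {r : Poly3} {m : ℕ} (hr : r.IsHomogeneous m) :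
    (dropThird r).IsHomogeneous m := by
  have := hr.aeval (n := 1) (![X 0, X 1, 0] : Fin 3 → MvPolynomial (Fin 2) ℝ) fun i => by
    fin_cases i
    exacts [isHomogeneous_X _ _, isHomogeneous_X _ _, isHomogeneous_zero _ _ _]
  rwa [one_mul] at this

theorem eval_dropThird {r : Poly3} (hr : pderiv 2 r = 0) (η : E3) :
    eval ![η 0, η 1] (dropThird r) = polyFun r η := by
  have hd (ξ : E3) : fderiv ℝ (polyFun r) ξ (EuclideanSpace.single 2 1) = 0 := by
    have := congrFun (partialDeriv_polyFun 2 r) ξ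
    rwa [hr, polyFun_zero] at this
  rw [← apply_add_smul_of_fderiv_eq_zero (contDiff_polyFun r) hd η (-η 2), polyFun, dropThird,
    aeval_eq_bind₁]
  change eval₂Hom (RingHom.id ℝ) _ (bind₁ _ r) = eval₂Hom (RingHom.id ℝ) _ r
  rw [eval₂Hom_bind₁]
  congr 2
  ext i
  fin_cases i <;> simp

/-- Normalization up to degree `k`; the terms of degree `k + 1` are treated by solving the
homological equation for the leading term of the remainder. -/
theorem exists_normalForm {v : E3 → E3} (hv : IsNilpotentDivFree v) {k : ℕ} (hk : 1 ≤ k) :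
    ∃ (w : E3 → E3) (p : MvPolynomial (Fin 2) ℝ), IsNilpotentDivFree w ∧ VolumeConjugate v w ∧
      (∀ m ∈ p.support, 2 ≤ m.degree ∧ m.degree ≤ k) ∧
      (fun η => w η - normalForm p η) =O[𝓝 0] fun η => ‖η‖ ^ (k + 1) := by
  induction k, hk using Nat.le_induction with
  | base =>
    refine ⟨v, 0, hv, VolumeConjugate.refl v, by simp, ?_⟩
    simpa [normalForm] using hv.isBigO_sub_linN
  | succ k hk ih =>
    obtain ⟨w, p, hw, hvw, hp, hO⟩ := ih
    obtain ⟨F, hF, hFdiv, hFO⟩ :=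
      exists_divFree_leading_term hw.contDiff hw.divergence_eq_zero p hO
    obtain ⟨h, r, hh, hhdiv, hr, hr2, h0, h1, h2⟩ :=
      exists_homological_solution (by omega) hF hFdiv
    obtain ⟨u, hu, hwu, huO⟩ :=
      exists_volumeConjugate_of_polyDiv_eq_zero (by omega) hh hhdiv hw
    refine ⟨u, p + dropThird r, hu, hvw.trans hwu, fun s hs => ?_, ?_⟩
    · classical
      rcases Finset.mem_union.1 (support_add hs) with hs | hs
      · have := hp s hs
        omega
      · have : s.degree = k + 1 := by
          by_contra hne
          exact (mem_support_iff.1 hs) ((isHomogeneous_dropThird hr).coeff_eq_zero hne)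
        omega
    · refine (huO.add hFO).congr_left fun η => ?_
      have key : polyField F η + polyField (lieBracketN h) η = polyFun r η • e₃ := by
        have h0' := congrArg (fun P => polyFun P η) h0
        have h1' := congrArg (fun P => polyFun P η) h1
        have h2' := congrArg (fun P => polyFun P η) h2
        simp only [polyFun_add, polyFun_sub, polyFun_zero] at h0' h1' h2'
        ext i
        fin_cases i <;> simp [polyField, lieBracketN, polyFun_sub, e₃, polyFun_zero]
        · linarith
        · linarith
        · linarith
      have e : normalForm (p + dropThird r) η = normalForm p η +
          (polyField F η + polyField (lieBracketN h) η) := by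
        rw [key, normalForm, normalForm, map_add, add_smul, eval_dropThird hr2, add_assoc]
      rw [e]
      abel

theorem isNilpotentDivFree_of_fderiv_eq {v : E3 → E3} (hv : ContDiff ℝ ∞ v)
    (hdiv : ∀ ξ, divergence v ξ = 0) (hv0 : v 0 = 0) (hDv0 : fderiv ℝ v 0 = linN) :
    IsNilpotentDivFree v := by
  refine ⟨hv, hdiv, ?_⟩
  have hR : ContDiff ℝ ∞ fun ξ => v ξ - linN ξ := hv.sub linN.contDiff
  refine isBigO_norm_pow_succ_of_fderiv (n := 1) (hR.differentiable (by simp)) (by simp [hv0]) ?_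
  have h0 : fderiv ℝ (fun ξ => v ξ - linN ξ) 0 = 0 := by
    rw [fderiv_fun_sub (hv.differentiable (by simp) 0) linN.differentiableAt, hDv0,
      ContinuousLinearMap.fderiv, sub_self]
  have h1 := ((hR.fderiv_right (m := ∞) (by simp)).differentiable (by simp) 0).isBigO_sub
  simpa [h0] using h1.norm_right

end

theorem theorem1 (v : E3 → E3) (hv : ContDiff ℝ ∞ v)
    (hdiv : ∀ ξ, divergence v ξ = 0)
    (hv0 : v 0 = 0) (hDv0 : fderiv ℝ v 0 = linN) (k : ℕ) :
    ∃ (ψ : Diffeomorph 𝓘(ℝ, E3) 𝓘(ℝ, E3) E3 E3 ∞) (w : E3 → E3) (p : MvPolynomial (Fin 2) ℝ),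
      IsVolumePreserving ψ ∧
      IsNearIdentity ψ ∧
      ContDiff ℝ ∞ w ∧
      Conjugates ψ v w ∧
      (∀ m ∈ p.support, 2 ≤ m.degree ∧ m.degree ≤ k) ∧
      (fun η => w η - normalForm p η) =O[𝓝 0] (fun η => ‖η‖ ^ (k + 1)) := by
  obtain ⟨w, p, hw, ⟨ψ, hψ, hψ', hψ''⟩, hp, hO⟩ := exists_normalForm
    (isNilpotentDivFree_of_fderiv_eq hv hdiv hv0 hDv0) (le_max_left 1 k)
  refine ⟨ψ, w, p, hψ, hψ', hw.contDiff, hψ'', fun m hm => ?_,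
    hO.trans (isBigO_norm_pow_mono (by omega))⟩
  -- For `k = 0` the normal form of degree `1` is used; it has no monomials at all.
  have := hp m hm
  omega
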